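/- Let $N\ge 2$, $d\ge 1$, and let $G$ be a connected undirected graph on the nodes $\{1,\dots,N\}$ (with $x\sim x$ for every $x$) carrying symmetric weights $\omega(x,y)=\omega(y,x)\ge 0$ with $\omega(x,y)>0$ if and only if $x\sim y$. Let $L^2$ be the space of functions $f:\{1,\dots,N\}\to\mathbb{R}^d$ with scalar product $(f,g)=\sum_x f(x)\cdot g(x)$ and norm $\|f\|=(f,f)^{1/2}$, let $H^1\subset L^2$ be the subspace of functions with zero average $\frac1N\sum_x f(x)=0$, and let $\Delta:H^1\to H^1$ be the graph Laplacian $\Delta f(x)=\sum_{y}\omega(x,y)\,(f(y)-f(x))$, with operator norm $$\|\Delta\|=\max_{u\in H^1\setminus\{0\}}\frac{|(u,\Delta u)|}{(u,u)}.$$ Let $\bar\tau\ge 0$. For a piecewise continuous delay $\tau:[0,\infty)\to[0,\bar\tau]$ (finitely many discontinuities in each bounded interval, with finite one-sided limits), a solution of $$\dot v_1(x,t)=\Delta v_1(x,t-\tau(t)),\qquad v_1(\cdot,t)\in H^1, \tag{$*$}$$ is a continuous function $t\mapsto v_1(\cdot,t)\in H^1$ on $[-\bar\tau,\infty)$ that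 satisfies $(*)$ at every $t>0$ at which $\tau$ is continuous. The zero solution is globally exponentially stable if there are constants $M,\gamma>0$ such that every solution satisfies $$\|v_1(\cdot,t)\|\le M e^{-\gamma t}\sup_{s\in[-\bar\tau,0]}\|v_1(\cdot,s)\|\qquad\text{for all } t\ge 0.$$ Then the zero solution of $(*)$ is globally exponentially stable for every piecewise continuous delay $\tau$ with $0\le\tau(t)\le\bar\tau$ if and only if $$\bar\tau<\frac{3}{2\|\Delta\|}.$$ -/

import Mathlib

open Set Filter Topology

namespace DelayConsensus

/-- An undirected weighted graph on the nodes `Fin N`: a neighbouring relation `Adj` with `x ∼ x`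
for every `x`, and nonnegative symmetric weights with `ω(x,y) > 0 ↔ x ∼ y`. -/
structure WGraph (N : ℕ) where
  Adj : Fin N → Fin N → Prop
  adj_self : ∀ x, Adj x x
  weight : Fin N → Fin N → ℝ
  weight_nonneg : ∀ x y, 0 ≤ weight x y
  weight_symm : ∀ x y, weight x y = weight y x
  weight_pos_iff : ∀ x y, 0 < weight x y ↔ Adj x y

/-- Every two nodes are joined by a finite path of neighbours. -/
def WGraph.Connected {N : ℕ} (G : WGraph N) : Prop :=
  ∀ x y, Relation.ReflTransGen G.Adj x y

/-- The Hilbert space of all functions from the nodes to `ℝ^d`, with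
`(f, g) = ∑ x, f x ⬝ g x`. -/
abbrev L2 (N d : ℕ) : Type := PiLp 2 (fun _ : Fin N => EuclideanSpace ℝ (Fin d))

instance instContinuousSMulL2 (N d : ℕ) : ContinuousSMul ℝ (L2 N d) :=
  IsBoundedSMul.continuousSMul

/-- The partial derivative `∂_y f(x) = f(y) - f(x)`. -/
def pd {N d : ℕ} (f : L2 N d) (y x : Fin N) : EuclideanSpace ℝ (Fin d) := f y - f x

/-- The average `(1/N) ∑ x, f x`. -/
noncomputable def average (N d : ℕ) : L2 N d →ₗ[ℝ] EuclideanSpace ℝ (Fin d) where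
  toFun f := (N : ℝ)⁻¹ • ∑ x, f x
  map_add' f g := by simp [Finset.sum_add_distrib]
  map_smul' c f := by
    simp only [PiLp.smul_apply, ← Finset.smul_sum, RingHom.id_apply]
    rw [smul_comm]

/-- `H¹(G | ℝ^d)`: the functions with zero average. -/
noncomputable def H1 (N d : ℕ) : Submodule ℝ (L2 N d) := LinearMap.ker (average N d)

instance instContinuousSMulH1 (N d : ℕ) : ContinuousSMul ℝ (H1 N d) :=
  IsBoundedSMul.continuousSMul

/-- The Laplacian `Δ f(x) = ∑ y, ω(x,y) ∂_y f(x)`. -/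
noncomputable def WGraph.laplacian {N : ℕ} (G : WGraph N) (d : ℕ) : L2 N d →ₗ[ℝ] L2 N d where
  toFun f := WithLp.toLp 2 fun x => ∑ y, G.weight x y • pd f y x
  map_add' f g := by
    ext x i
    simp [pd, ← Finset.sum_add_distrib]
    exact Finset.sum_congr rfl fun y _ => by ring
  map_smul' c f := by
    ext x i
    simp [pd, Finset.mul_sum]
    exact Finset.sum_congr rfl fun y _ => by ring

theorem WGraph.laplacian_mem_H1 {N : ℕ} (G : WGraph N) (d : ℕ) (f : L2 N d) :
    G.laplacian d f ∈ H1 N d := by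
  have h : ∑ x, ∑ y, G.weight x y • pd f y x = -∑ x, ∑ y, G.weight x y • pd f y x := by
    conv_lhs => rw [Finset.sum_comm]
    rw [← Finset.sum_neg_distrib]
    refine Finset.sum_congr rfl fun x _ => ?_
    rw [← Finset.sum_neg_distrib]
    refine Finset.sum_congr rfl fun y _ => ?_
    rw [G.weight_symm y x, ← smul_neg]
    congr 1
    simp [pd]
  have h0 : ∑ x, ∑ y, G.weight x y • pd f y x = 0 := by
    ext i
    have hi := congrArg (fun g : EuclideanSpace ℝ (Fin d) => g i) h
    simp only [PiLp.neg_apply] at hi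
    rw [PiLp.zero_apply]
    linarith
  rw [H1, LinearMap.mem_ker]
  change (N : ℝ)⁻¹ • ∑ x, ∑ y, G.weight x y • pd f y x = 0
  rw [h0, smul_zero]

/-- The Laplacian as an operator on `H¹`. -/
noncomputable def WGraph.laplacianH1 {N : ℕ} (G : WGraph N) (d : ℕ) : H1 N d →ₗ[ℝ] H1 N d :=
  (G.laplacian d).restrict fun f _ => G.laplacian_mem_H1 d f

/-- The operator norm `‖Δ‖ = max_{u ∈ H¹, u ≠ 0} |(u, Δ u)| / (u, u)`. -/
noncomputable def WGraph.laplacianNorm {N : ℕ} (G : WGraph N) (d : ℕ) : ℝ :=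
  sSup {q : ℝ | ∃ u : H1 N d, u ≠ 0 ∧
    q = |inner ℝ u (G.laplacianH1 d u)| / inner ℝ u u}

/-- Piecewise continuity on `[0, ∞)`: finitely many discontinuities in each bounded interval, with
finite one-sided limits everywhere. -/
def PiecewiseContinuous (τ : ℝ → ℝ) : Prop :=
  (∀ T : ℝ, {t : ℝ | t ∈ Icc 0 T ∧ ¬ ContinuousWithinAt τ (Ici 0) t}.Finite) ∧
  (∀ t : ℝ, 0 ≤ t → ∃ l : ℝ, Tendsto τ (𝓝[>] t) (𝓝 l)) ∧
  (∀ t : ℝ, 0 < t → ∃ l : ℝ, Tendsto τ (𝓝[<] t) (𝓝 l))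

/-- `v` is a solution in `H¹` of `v'(t) = Δ v(t - τ(t))` with initial function `v` on `[-τbar, 0]`:
it is continuous on `[-τbar, ∞)` and satisfies the equation at each `t > 0` at which `τ` is
continuous. Only the values on `[-τbar, ∞)` matter. -/
def WGraph.IsSolution {N : ℕ} (G : WGraph N) (d : ℕ) (τbar : ℝ) (τ : ℝ → ℝ) (v : ℝ → H1 N d) :
    Prop :=
  ContinuousOn v (Ici (-τbar)) ∧
  ∀ t : ℝ, 0 < t → ContinuousAt τ t → HasDerivAt v (G.laplacianH1 d (v (t - τ t))) t

/-- The zero solution is globally exponentially stable: for some `M, γ > 0`, every solution (that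
is, for every continuous initial function) satisfies
`‖v(t)‖ ≤ M exp(-γ t) sup_{s ∈ [-τbar, 0]} ‖v(s)‖` for all `t ≥ 0`. -/
def WGraph.GloballyExponentiallyStable {N : ℕ} (G : WGraph N) (d : ℕ) (τbar : ℝ) (τ : ℝ → ℝ) :
    Prop :=
  ∃ M γ : ℝ, 0 < M ∧ 0 < γ ∧ ∀ v : ℝ → H1 N d, G.IsSolution d τbar τ v →
    ∀ t : ℝ, 0 ≤ t →
      ‖v t‖ ≤ M * Real.exp (-γ * t) * sSup ((fun s => ‖v s‖) '' Icc (-τbar) 0)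

end DelayConsensus

/-!
The Laplacian on `H¹` is symmetric, and by connectedness negative definite, so in an orthonormal
eigenbasis the equation splits into scalar equations `x'(t) = -lam * x (t - τ t)` with
`0 < lam ≤ ‖Δ‖`, and `‖Δ‖` is itself attained as such a `lam`.

*Stability below the threshold.* Let the delays be bounded by `h` with `1 ≤ lam * h < 3 / 2`
(`h` may be enlarged to achieve the first inequality). If `|x| ≤ A` so far and `x` has a zero at
`t₀`, then at time `t₀ + u` the delayed argument is either past `t₀` or within `h - u` of it, where
`x` is Lipschitz with constant `lam * A`. Hence, while `x` stays positive, its slope is at most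
`lam * A * max 0 (min 1 (lam * (h - u)))`, which integrates to `(lam * h - 1 / 2) * A < A`
(`IsScalarDelaySolution.le_of_pos_after_zero`). A solution without zeros is eventually monotone and
satisfies `x' ≤ -lam * x` (`IsScalarDelaySolution.mul_le_of_pos`). In both cases a bound on a window
of fixed length improves by the fixed factor `lam * h - 1 / 2 < 1` after a fixed time
(`IsScalarDelaySolution.abs_le_mul_of_window`), and iterating gives exponential decay
(`exists_exp_decay_scalar`).

*Instability at and above the threshold.* For the rate `1`, let the delay be the time elapsed since
the last multiple of `5 / 2`, cut off at `3 / 2`. Starting from `-1`, the solution keeps slope `1`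
until time `3 / 2`, where it is `1 / 2`, and then rises along a parabola to the value `1` at time
`5 / 2`, where the delay jumps back to `0` and the process repeats with the opposite sign. Rescaled
to the rate `‖Δ‖` and multiplied by a top eigenvector (`hasDerivAt_sawWave`,
`WGraph.not_stable_sawDelay`), it is a nonzero periodic solution with delays at most
`3 / (2 * ‖Δ‖)`.
-/

namespace DelayConsensus

/-! ### Comparison of increments -/

/-- Mean value inequality with finitely many exceptional points: a continuous function whose
derivative is dominated by that of `g` off a finite set grows no more than `g`. -/
theorem sub_le_sub_of_hasDerivAt_le_off_finite {f g f' g' : ℝ → ℝ} (F : Finset ℝ) :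
    ∀ {a b : ℝ}, a ≤ b → ContinuousOn f (Icc a b) → (∀ t, HasDerivAt g (g' t) t) →
      (∀ t ∈ Ioo a b, t ∉ F → HasDerivAt f (f' t) t ∧ f' t ≤ g' t) → f b - f a ≤ g b - g a := by
  induction F using Finset.induction_on with
  | empty =>
    intro a b hab hf hg hd
    have hanti : AntitoneOn (fun t => f t - g t) (Icc a b) := by
      refine antitoneOn_of_hasDerivWithinAt_nonpos (convex_Icc a b)
        (f' := fun t => f' t - g' t)
        (hf.sub fun t _ => (hg t).continuousAt.continuousWithinAt) ?_ ?_
      · intro t ht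
        rw [interior_Icc] at ht
        exact ((hd t ht (by simp)).1.sub (hg t)).hasDerivWithinAt
      · intro t ht
        rw [interior_Icc] at ht
        have := (hd t ht (by simp)).2
        linarith
    have := hanti (left_mem_Icc.2 hab) (right_mem_Icc.2 hab) hab
    simp only at this
    linarith
  | insert c F _ ih =>
    intro a b hab hf hg hd
    by_cases hc : c ∈ Ioo a b
    · have h1 := ih hc.1.le (hf.mono (Icc_subset_Icc_right hc.2.le)) hg fun t ht htF =>
        hd t ⟨ht.1, ht.2.trans hc.2⟩ (by simp [htF, ht.2.ne])
      have h2 := ih hc.2.le (hf.mono (Icc_subset_Icc_left hc.1.le)) hg fun t ht htF =>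
        hd t ⟨hc.1.trans ht.1, ht.2⟩ (by simp [htF, ht.1.ne'])
      linarith
    · refine ih hab hf hg fun t ht htF => hd t ht ?_
      have : t ≠ c := fun h => hc (h ▸ ht)
      simp [htF, this]

/-! ### The scalar equation -/

/-- `x` solves `x'(t) = -lam * x (t - τ t)` for `t > 0` off the locally finite set `E`, with delays
in `[0, r]` and history on `[-r, 0]`. -/
structure IsScalarDelaySolution (lam r : ℝ) (E : Set ℝ) (τ x : ℝ → ℝ) : Prop where
  lam_pos : 0 < lam
  r_nonneg : 0 ≤ r
  continuousOn : ContinuousOn x (Ici (-r))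
  delay_nonneg : ∀ t, 0 ≤ t → 0 ≤ τ t
  delay_le : ∀ t, 0 ≤ t → τ t ≤ r
  finite : ∀ T : ℝ, (E ∩ Icc 0 T).Finite
  hasDerivAt : ∀ t, 0 < t → t ∉ E → HasDerivAt x (-lam * x (t - τ t)) t

/-! ### The 3/2 contraction for the scalar equation -/

namespace IsScalarDelaySolution

variable {lam r : ℝ} {E : Set ℝ} {τ x : ℝ → ℝ}

theorem neg (hx : IsScalarDelaySolution lam r E τ x) :
    IsScalarDelaySolution lam r E τ (fun t => -x t) where
  lam_pos := hx.lam_pos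
  r_nonneg := hx.r_nonneg
  continuousOn := hx.continuousOn.neg
  delay_nonneg := hx.delay_nonneg
  delay_le := hx.delay_le
  finite := hx.finite
  hasDerivAt t ht hE := by
    have := (hx.hasDerivAt t ht hE).neg
    rwa [← mul_neg] at this

theorem sub_le_sub (hx : IsScalarDelaySolution lam r E τ x) {g g' : ℝ → ℝ} {a b : ℝ} (ha : 0 ≤ a)
    (hab : a ≤ b) (hg : ∀ t, HasDerivAt g (g' t) t)
    (h : ∀ t ∈ Ioo a b, -lam * x (t - τ t) ≤ g' t) : x b - x a ≤ g b - g a := by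
  refine sub_le_sub_of_hasDerivAt_le_off_finite (f' := fun t => -lam * x (t - τ t))
    (hx.finite b).toFinset hab (hx.continuousOn.mono fun t ht => ?_) hg fun t ht htF => ?_
  · exact (neg_nonpos.2 hx.r_nonneg).trans (ha.trans ht.1)
  · have h0 : 0 < t := ha.trans_lt ht.1
    refine ⟨hx.hasDerivAt t h0 fun hE => htF ?_, h t ht⟩
    simpa using ⟨hE, h0.le, ht.2.le⟩

theorem sub_le_mul (hx : IsScalarDelaySolution lam r E τ x) {C a b : ℝ} (ha : 0 ≤ a)
    (hab : a ≤ b) (h : ∀ t ∈ Ioo a b, -lam * x (t - τ t) ≤ C) : x b - x a ≤ C * (b - a) := by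
  have := hx.sub_le_sub (g := fun t => C * t) (g' := fun _ => C) ha hab
    (fun t => by simpa using (hasDerivAt_id t).const_mul C) h
  linarith

/-- On a bounded time interval a solution is bounded by a multiple of the bound on its history:
each step of length `1 / (2 * lam)` at most doubles the bound. -/
theorem abs_le_two_pow (hx : IsScalarDelaySolution lam r E τ x) {B : ℝ}
    (hB : ∀ t ∈ Icc (-r) 0, |x t| ≤ B) (n : ℕ) :
    ∀ t ∈ Icc (-r) (n / (2 * lam)), |x t| ≤ 2 ^ n * B := by
  have hl := hx.lam_pos
  have hr := hx.r_nonneg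
  have hB0 : 0 ≤ B := (abs_nonneg _).trans (hB 0 ⟨by linarith, le_rfl⟩)
  induction n with
  | zero => simpa using hB
  | succ n ih =>
    set p : ℝ := n / (2 * lam) with hp
    have hp0 : 0 ≤ p := by positivity
    have hq : ((n + 1 : ℕ) : ℝ) / (2 * lam) = p + 1 / (2 * lam) := by
      rw [hp]; push_cast; ring
    rw [hq]
    have hδ : 0 < 1 / (2 * lam) := by positivity
    have hne : (Icc (-r) (p + 1 / (2 * lam))).Nonempty := nonempty_Icc.2 (by linarith)
    obtain ⟨t₁, ht₁, hmax⟩ := isCompact_Icc.exists_isMaxOn hne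
      ((hx.continuousOn.mono fun t ht => ht.1).abs)
    have hmax' : ∀ t ∈ Icc (-r) (p + 1 / (2 * lam)), |x t| ≤ |x t₁| := fun t ht => hmax ht
    suffices h : |x t₁| ≤ 2 ^ (n + 1) * B from fun t ht => (hmax' t ht).trans h
    have hpow : (2 : ℝ) ^ n * B ≤ 2 ^ (n + 1) * B := by
      rw [pow_succ]; nlinarith [mul_nonneg (pow_nonneg (zero_le_two (α := ℝ)) n) hB0]
    rcases le_total t₁ p with h | h
    · exact (ih t₁ ⟨ht₁.1, h⟩).trans hpow
    have hb : ∀ t ∈ Ioo p t₁, |x (t - τ t)| ≤ |x t₁| := by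
      intro t ht
      have h0 : 0 ≤ t := hp0.trans ht.1.le
      have h1 := hx.delay_nonneg t h0
      have h2 := hx.delay_le t h0
      exact hmax' _ ⟨by linarith, by linarith [ht.2, ht₁.2]⟩
    have hstep : lam * |x t₁| * (t₁ - p) ≤ |x t₁| / 2 := by
      have h3 : lam * (t₁ - p) ≤ 1 / 2 := by
        have : t₁ - p ≤ 1 / (2 * lam) := by linarith [ht₁.2]
        calc lam * (t₁ - p) ≤ lam * (1 / (2 * lam)) := by gcongr
          _ = 1 / 2 := by field_simp
      nlinarith [abs_nonneg (x t₁)]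
    have hup := hx.sub_le_mul (C := lam * |x t₁|) hp0 h fun t ht => by
      have := neg_le_of_abs_le (hb t ht)
      nlinarith
    have hlo := hx.neg.sub_le_mul (C := lam * |x t₁|) hp0 h fun t ht => by
      have := le_of_abs_le (hb t ht)
      nlinarith
    have hxp := abs_le.1 (ih p ⟨by linarith, le_rfl⟩)
    have : |x t₁| ≤ 2 ^ n * B + |x t₁| / 2 := abs_le.2 ⟨by linarith, by linarith⟩
    rw [pow_succ]
    linarith

variable {h A s : ℝ}

/-- After a zero `t₀`, and as long as the solution stays positive, it cannot exceed
`(lam * h - 1 / 2) * A`, where `A` bounds it before `t₀`. With `u = t - t₀`, the slope is at most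
`lam * A`, at most `lam ^ 2 * A * (h - u)` because the delayed argument lies within `h - u` of the
zero, and nonpositive for `u ≥ h`. -/
theorem le_of_pos_after_zero (hx : IsScalarDelaySolution lam r E τ x) (hrh : r ≤ h)
    (hlh : 1 ≤ lam * h) (hs : 0 ≤ s) {t₀ t₁ : ℝ} (hst : s + 2 * h ≤ t₀)
    (hA : ∀ t ∈ Icc s t₀, |x t| ≤ A) (h01 : t₀ ≤ t₁) (hzero : x t₀ = 0)
    (hpos : ∀ t ∈ Ioc t₀ t₁, 0 < x t) : x t₁ ≤ (lam * h - 1 / 2) * A := by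
  have hl := hx.lam_pos
  have hh : 0 < h := by
    by_contra hcon
    nlinarith
  have hA0 : 0 ≤ A := (abs_nonneg _).trans (hA t₀ ⟨by linarith, le_rfl⟩)
  -- Near the zero the solution is Lipschitz with constant `lam * A`.
  have hlip : ∀ p ∈ Icc (t₀ - h) t₀, -x p ≤ lam * A * (t₀ - p) := by
    intro p hp
    have := hx.sub_le_mul (C := lam * A) (by linarith [hp.1]) hp.2 fun t ht => by
      have h0 : 0 ≤ t := by linarith [hp.1, ht.1]
      have h1 := hx.delay_nonneg t h0
      have h2 := hx.delay_le t h0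
      have := neg_le_of_abs_le (hA (t - τ t) ⟨by linarith [hp.1, ht.1], by linarith [ht.2]⟩)
      nlinarith
    linarith
  have hslope : ∀ t ∈ Ioo t₀ t₁, -lam * x (t - τ t) ≤ 0 ∨
      (t < t₀ + h ∧ -lam * x (t - τ t) ≤ lam * A ∧
        -lam * x (t - τ t) ≤ lam ^ 2 * A * (h - (t - t₀))) := by
    intro t ht
    have h0 : 0 ≤ t := by linarith [ht.1]
    have h1 := hx.delay_nonneg t h0
    have h2 := hx.delay_le t h0
    rcases le_or_gt t₀ (t - τ t) with hc | hc
    · left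
      have : 0 ≤ x (t - τ t) := by
        rcases hc.eq_or_lt with he | hc
        · rw [← he, hzero]
        · exact (hpos _ ⟨hc, by linarith [ht.2]⟩).le
      nlinarith
    · right
      have hAt := neg_le_of_abs_le (hA (t - τ t) ⟨by linarith [ht.1], hc.le⟩)
      have hLt := hlip (t - τ t) ⟨by linarith [ht.1], hc.le⟩
      refine ⟨by linarith, by nlinarith, ?_⟩
      calc -lam * x (t - τ t) = lam * -x (t - τ t) := by ring
        _ ≤ lam * (lam * A * (t₀ - (t - τ t))) := by gcongr
        _ ≤ lam * (lam * A * (h - (t - t₀))) := by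
          have : t₀ - (t - τ t) ≤ h - (t - t₀) := by linarith
          gcongr
        _ = _ := by ring
  have hinv : lam * (1 / lam) = 1 := by field_simp
  have hih : 1 / lam ≤ h := by rw [div_le_iff₀ hl]; linarith
  have hi0 : 0 < 1 / lam := by positivity
  -- The two slope bounds agree at `u = h - 1 / lam`.
  set a₁ := min t₁ (t₀ + (h - 1 / lam)) with ha₁
  set a₂ := min t₁ (t₀ + h) with ha₂
  have h0a : t₀ ≤ a₁ := le_min h01 (by linarith)
  have haa : a₁ ≤ a₂ := min_le_min le_rfl (by linarith)
  have ha1 : a₂ ≤ t₁ := min_le_left _ _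
  have e1 := hx.sub_le_mul (C := lam * A) (a := t₀) (b := a₁) (by linarith) h0a fun t ht => by
    rcases hslope t ⟨ht.1, by linarith [ht.2]⟩ with hc | hc
    · nlinarith [mul_nonneg hl.le hA0]
    · exact hc.2.1
  have e2 := hx.sub_le_sub (g := fun t => -(lam ^ 2 * A / 2 * (h - (t - t₀)) ^ 2))
    (g' := fun t => lam ^ 2 * A * (h - (t - t₀))) (a := a₁) (b := a₂) (by linarith) haa
    (fun t => by
      have := ((((hasDerivAt_id t).sub_const t₀).const_sub h).pow 2).const_mul (lam ^ 2 * A / 2)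
      refine this.neg.congr_deriv ?_
      simp
      ring) fun t ht => by
    rcases hslope t ⟨by linarith [ht.1], by linarith [ht.2]⟩ with hc | hc
    · have h4 : t ≤ t₀ + h := ht.2.le.trans (min_le_right _ _)
      have : 0 ≤ lam ^ 2 * A * (h - (t - t₀)) := mul_nonneg (by positivity) (by linarith)
      linarith
    · exact hc.2.2
  have e3 := hx.sub_le_mul (C := 0) (a := a₂) (b := t₁) (by linarith) ha1 fun t ht => by
    rcases hslope t ⟨by linarith [ht.1], ht.2⟩ with hc | hc
    · exact hc
    · exfalso
      have : a₂ < t₀ + h := ht.1.trans hc.1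
      rcases min_choice t₁ (t₀ + h) with h5 | h5
      · rw [← ha₂] at h5; linarith [ht.1, ht.2]
      · rw [← ha₂] at h5; linarith
  have e4 : a₁ - t₀ ≤ h - 1 / lam := by linarith [min_le_right t₁ (t₀ + (h - 1 / lam))]
  have e5 : 0 ≤ lam ^ 2 * A / 2 * (h - (a₂ - t₀)) ^ 2 := by positivity
  have e6 : lam ^ 2 * A / 2 * (h - (a₁ - t₀)) ^ 2 - lam ^ 2 * A / 2 * (h - (a₂ - t₀)) ^ 2
      ≤ A / 2 := by
    rcases min_choice t₁ (t₀ + (h - 1 / lam)) with h5 | h5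
    · rw [← ha₁] at h5
      have : a₂ = a₁ := le_antisymm (by linarith) haa
      rw [this]; linarith
    · rw [← ha₁] at h5
      have : lam ^ 2 * A / 2 * (h - (a₁ - t₀)) ^ 2 = A / 2 := by
        rw [h5]; field_simp; ring
      linarith
  have e7 : lam * A * (a₁ - t₀) ≤ (lam * h - 1) * A := by
    calc lam * A * (a₁ - t₀) ≤ lam * A * (h - 1 / lam) := by gcongr
      _ = (lam * h - 1) * A := by field_simp
  linarith

/-- A bound `A` up to time `t` improves to `(lam * h - 1 / 2) * A` at `t` if there is an earlier
zero: apply `le_of_pos_after_zero` to the solution or its negative from its last zero on. -/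
theorem abs_le_of_zero (hx : IsScalarDelaySolution lam r E τ x) (hrh : r ≤ h)
    (hlh : 1 ≤ lam * h) (hs : 0 ≤ s) {z t : ℝ} (hz : s + 2 * h ≤ z) (hzt : z ≤ t)
    (hxz : x z = 0) (hA : ∀ p ∈ Icc s t, |x p| ≤ A) : |x t| ≤ (lam * h - 1 / 2) * A := by
  have hh : 0 ≤ h := hx.r_nonneg.trans hrh
  have hA0 : 0 ≤ A := (abs_nonneg _).trans (hA t ⟨by linarith, le_rfl⟩)
  have hsub : Icc z t ⊆ Ici (-r) := fun p hp => by
    have := hx.r_nonneg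
    simp only [mem_Ici]; linarith [hp.1]
  -- the last zero before `t`
  have hcl : IsCompact (Icc z t ∩ x ⁻¹' {0}) :=
    isCompact_Icc.of_isClosed_subset
      ((hx.continuousOn.mono hsub).preimage_isClosed_of_isClosed isClosed_Icc isClosed_singleton)
      inter_subset_left
  obtain ⟨t₀, ⟨ht₀, hx₀⟩, hlast⟩ := hcl.exists_isGreatest ⟨z, ⟨le_rfl, hzt⟩, hxz⟩
  have hne : ∀ p ∈ Ioc t₀ t, x p ≠ 0 := fun p hp h0 =>
    (hlast ⟨⟨ht₀.1.trans hp.1.le, hp.2⟩, h0⟩).not_gt hp.1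
  have hcon : ContinuousOn x (Icc t₀ t) :=
    hx.continuousOn.mono ((Icc_subset_Icc_left ht₀.1).trans hsub)
  have hA' : ∀ p ∈ Icc s t₀, |x p| ≤ A := fun p hp => hA p ⟨hp.1, hp.2.trans ht₀.2⟩
  have hst₀ : s + 2 * h ≤ t₀ := hz.trans ht₀.1
  rcases lt_trichotomy (x t) 0 with hneg | h0 | hpos
  · rw [abs_of_neg hneg]
    refine hx.neg.le_of_pos_after_zero hrh hlh hs hst₀ (by simpa using hA') ht₀.2
      (by simpa using hx₀) fun p hp => ?_
    by_contra hc
    have hc' : 0 < x p := lt_of_le_of_ne (by linarith) (hne p hp).symm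
    obtain ⟨w, hw, hw0⟩ := intermediate_value_Icc' hp.2
      (hcon.mono (Icc_subset_Icc_left hp.1.le)) (show (0 : ℝ) ∈ _ from ⟨hneg.le, hc'.le⟩)
    exact hne w ⟨hp.1.trans_le hw.1, hw.2⟩ hw0
  · rw [h0, abs_zero]
    exact mul_nonneg (by linarith) hA0
  · rw [abs_of_pos hpos]
    refine hx.le_of_pos_after_zero hrh hlh hs hst₀ hA' ht₀.2 hx₀ fun p hp => ?_
    by_contra hc
    obtain ⟨w, hw, hw0⟩ := intermediate_value_Icc hp.2
      (hcon.mono (Icc_subset_Icc_left hp.1.le)) (show (0 : ℝ) ∈ _ from ⟨not_lt.1 hc, hpos.le⟩)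
    exact hne w ⟨hp.1.trans_le hw.1, hw.2⟩ hw0

/-- A solution that stays positive is nonincreasing after one delay, hence satisfies
`x' ≤ -lam * x` after another one. -/
theorem mul_le_of_pos (hx : IsScalarDelaySolution lam r E τ x) (hrh : r ≤ h) (hs : 0 ≤ s) {t : ℝ}
    (ht : s + 4 * h ≤ t) (hpos : ∀ p ∈ Icc (s + 2 * h) t, 0 < x p) :
    x t * (1 + lam * (t - (s + 4 * h))) ≤ x (s + 4 * h) := by
  have hl := hx.lam_pos
  have hh : 0 ≤ h := hx.r_nonneg.trans hrh
  have hmono : ∀ a b, s + 3 * h ≤ a → a ≤ b → b ≤ t → x b ≤ x a := by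
    intro a b ha hab hbt
    have := hx.sub_le_mul (C := 0) (by linarith) hab fun p hp => by
      have h0 : 0 ≤ p := by linarith [hp.1]
      have h1 := hx.delay_nonneg p h0
      have h2 := hx.delay_le p h0
      have := hpos (p - τ p) ⟨by linarith [hp.1], by linarith [hp.2]⟩
      nlinarith
    linarith
  have := hx.sub_le_mul (C := -lam * x t) (by linarith) ht fun p hp => by
    have h0 : 0 ≤ p := by linarith [hp.1]
    have h1 := hx.delay_nonneg p h0
    have h2 := hx.delay_le p h0
    have := hmono (p - τ p) t (by linarith [hp.1]) (by linarith [hp.2]) le_rfl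
    nlinarith
  nlinarith

theorem abs_mul_le_of_ne_zero (hx : IsScalarDelaySolution lam r E τ x) (hrh : r ≤ h) (hs : 0 ≤ s)
    {t : ℝ} (ht : s + 4 * h ≤ t) (hne : ∀ p ∈ Icc (s + 2 * h) t, x p ≠ 0) :
    |x t| * (1 + lam * (t - (s + 4 * h))) ≤ |x (s + 4 * h)| := by
  have hh : 0 ≤ h := hx.r_nonneg.trans hrh
  have hcon : ContinuousOn x (Icc (s + 2 * h) t) := hx.continuousOn.mono fun p hp => by
    have := hx.r_nonneg
    simp only [mem_Ici]; linarith [hp.1]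
  have h4 : s + 4 * h ∈ Icc (s + 2 * h) t := ⟨by linarith, ht⟩
  have htm : t ∈ Icc (s + 2 * h) t := ⟨by linarith, le_rfl⟩
  rcases (hne t htm).lt_or_gt with hneg | hpos
  · have hall : ∀ p ∈ Icc (s + 2 * h) t, 0 < -x p := by
      intro p hp
      by_contra hc
      obtain ⟨w, hw, hw0⟩ := intermediate_value_Icc' hp.2
        (hcon.mono (Icc_subset_Icc_left hp.1)) (show (0 : ℝ) ∈ _ from ⟨hneg.le, by linarith⟩)
      exact hne w ⟨hp.1.trans hw.1, hw.2⟩ hw0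
    rw [abs_of_neg hneg, abs_of_neg (by linarith [hall _ h4])]
    exact hx.neg.mul_le_of_pos hrh hs ht hall
  · have hall : ∀ p ∈ Icc (s + 2 * h) t, 0 < x p := by
      intro p hp
      by_contra hc
      obtain ⟨w, hw, hw0⟩ := intermediate_value_Icc hp.2
        (hcon.mono (Icc_subset_Icc_left hp.1)) (show (0 : ℝ) ∈ _ from ⟨not_lt.1 hc, hpos.le⟩)
      exact hne w ⟨hp.1.trans hw.1, hw.2⟩ hw0
    rw [abs_of_pos hpos, abs_of_pos (hall _ h4)]
    exact hx.mul_le_of_pos hrh hs ht hall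

/-- A bound on a window of length `4 * h` persists forever when `lam * h < 3 / 2`: a new maximum
of `|x|` past the window could neither follow a zero nor end a stretch without zeros. -/
theorem abs_le_of_window (hx : IsScalarDelaySolution lam r E τ x) (hrh : r ≤ h)
    (hlh : 1 ≤ lam * h) (hlt : lam * h < 3 / 2) (hs : 0 ≤ s)
    (hA : ∀ t ∈ Icc s (s + 4 * h), |x t| ≤ A) {t : ℝ} (ht : s ≤ t) : |x t| ≤ A := by
  have hl := hx.lam_pos
  have hh : 0 ≤ h := hx.r_nonneg.trans hrh
  have hA0 : 0 ≤ A := (abs_nonneg _).trans (hA s ⟨le_rfl, by linarith⟩)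
  obtain ⟨t₁, ht₁, hmax⟩ := isCompact_Icc.exists_isMaxOn (nonempty_Icc.2 ht)
    ((hx.continuousOn.mono (t := Icc s t) fun p hp => by
      have := hx.r_nonneg
      simp only [mem_Ici]; linarith [hp.1]).abs)
  refine (show |x t| ≤ |x t₁| from hmax ⟨ht, le_rfl⟩).trans ?_
  rcases le_total t₁ (s + 4 * h) with hc | hc
  · exact hA t₁ ⟨ht₁.1, hc⟩
  by_cases hz : ∃ z ∈ Icc (s + 2 * h) t₁, x z = 0
  · obtain ⟨z, hz, hxz⟩ := hz
    have := hx.abs_le_of_zero (A := |x t₁|) hrh hlh hs hz.1 hz.2 hxz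
      fun p hp => hmax ⟨hp.1, hp.2.trans ht₁.2⟩
    nlinarith [abs_nonneg (x t₁)]
  · push Not at hz
    have h1 := hx.abs_mul_le_of_ne_zero hrh hs hc hz
    have h2 := hA (s + 4 * h) ⟨by linarith, le_rfl⟩
    have h3 : 0 ≤ |x t₁| * (lam * (t₁ - (s + 4 * h))) :=
      mul_nonneg (abs_nonneg _) (mul_nonneg hl.le (by linarith))
    linarith

/-- Past a window of length `4 * h + 2 / lam`, the bound improves by the factor
`lam * h - 1 / 2 < 1`. -/
theorem abs_le_mul_of_window (hx : IsScalarDelaySolution lam r E τ x) (hrh : r ≤ h)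
    (hlh : 1 ≤ lam * h) (hlt : lam * h < 3 / 2) (hs : 0 ≤ s)
    (hA : ∀ t ∈ Icc s (s + 4 * h), |x t| ≤ A) {t : ℝ}
    (ht : s + (4 * h + 2 / lam) ≤ t) : |x t| ≤ (lam * h - 1 / 2) * A := by
  have hl := hx.lam_pos
  have hh : 0 ≤ h := hx.r_nonneg.trans hrh
  have hl2 : 0 < 2 / lam := by positivity
  by_cases hz : ∃ z ∈ Icc (s + 2 * h) t, x z = 0
  · obtain ⟨z, hz, hxz⟩ := hz
    exact hx.abs_le_of_zero hrh hlh hs hz.1 hz.2 hxz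
      fun p hp => hx.abs_le_of_window hrh hlh hlt hs hA hp.1
  · push Not at hz
    have h1 := hx.abs_mul_le_of_ne_zero hrh hs (by linarith) hz
    have h2 := hA (s + 4 * h) ⟨by linarith, le_rfl⟩
    have h3 : 2 ≤ lam * (t - (s + 4 * h)) := by
      calc (2 : ℝ) = lam * (2 / lam) := by field_simp
        _ ≤ _ := by gcongr; linarith
    nlinarith [abs_nonneg (x t), mul_le_mul_of_nonneg_left h3 (abs_nonneg (x t))]

end IsScalarDelaySolution

/-- If `lam * r < 3 / 2`, solutions of the scalar equation decay exponentially, with constants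
depending only on `lam` and `r`. -/
theorem exists_exp_decay_scalar {lam r : ℝ} (hl : 0 < lam) (hlr : lam * r < 3 / 2) :
    ∃ M γ : ℝ, 0 < M ∧ 0 < γ ∧ ∀ (E : Set ℝ) (τ x : ℝ → ℝ) (B : ℝ),
      IsScalarDelaySolution lam r E τ x → (∀ t ∈ Icc (-r) 0, |x t| ≤ B) →
      ∀ t, 0 ≤ t → |x t| ≤ M * Real.exp (-γ * t) * B := by
  -- Enlarging the bound on the delays makes `lam * h ≥ 1`.
  obtain ⟨h, hrh, hlh, hlt⟩ : ∃ h, r ≤ h ∧ 1 ≤ lam * h ∧ lam * h < 3 / 2 := by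
    have h1 : lam * (1 / lam) = 1 := by field_simp
    rcases le_total r (1 / lam) with hc | hc
    · exact ⟨1 / lam, hc, h1.ge, by rw [h1]; norm_num⟩
    · exact ⟨r, le_rfl, by rw [← h1]; gcongr, hlr⟩
  have hh : 0 < h := by
    by_contra hcon
    nlinarith
  set ρ : ℝ := lam * h - 1 / 2 with hρ
  set W : ℝ := 4 * h + 2 / lam with hW
  have hl2 : 0 < 2 / lam := by positivity
  have hρ0 : 0 < ρ := by linarith
  have hρ1 : ρ < 1 := by linarith
  have hW0 : 0 < W := by positivity
  obtain ⟨k, hk⟩ := exists_nat_ge (4 * h * (2 * lam))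
  have hγ : 0 < -Real.log ρ / W := div_pos (neg_pos.2 (Real.log_neg hρ0 hρ1)) hW0
  refine ⟨ρ⁻¹ * 2 ^ k, -Real.log ρ / W, by positivity, hγ, ?_⟩
  intro E τ x B hx hB t ht
  have hB0 : 0 ≤ B := (abs_nonneg _).trans (hB 0 ⟨by linarith [hx.r_nonneg], le_rfl⟩)
  have hk' : 4 * h ≤ k / (2 * lam) := by rwa [le_div_iff₀ (by positivity)]
  have hwin : ∀ p ∈ Icc (0 : ℝ) (0 + 4 * h), |x p| ≤ 2 ^ k * B := fun p hp =>
    hx.abs_le_two_pow hB k p ⟨by linarith [hx.r_nonneg, hp.1], by linarith [hp.2]⟩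
  have hiter : ∀ n : ℕ, ∀ p : ℝ, n * W ≤ p → |x p| ≤ ρ ^ n * (2 ^ k * B) := by
    intro n
    induction n with
    | zero =>
      intro p hp
      simpa using hx.abs_le_of_window hrh hlh hlt le_rfl hwin (by simpa using hp)
    | succ n ih =>
      intro p hp
      rw [pow_succ', mul_assoc]
      refine hx.abs_le_mul_of_window (s := n * W) hrh hlh hlt (by positivity)
        (fun q hq => ih q hq.1) ?_
      push_cast at hp
      linarith
  have hfl : (⌊t / W⌋₊ : ℝ) * W ≤ t := by
    rw [← le_div_iff₀ hW0]; exact Nat.floor_le (by positivity)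
  refine (hiter ⌊t / W⌋₊ t hfl).trans ?_
  have hexp : ρ ^ ⌊t / W⌋₊ ≤ ρ⁻¹ * Real.exp (-(-Real.log ρ / W) * t) := by
    have h1 : ρ⁻¹ * Real.exp (-(-Real.log ρ / W) * t) = ρ ^ (t / W - 1) := by
      rw [Real.rpow_sub_one hρ0.ne', Real.rpow_def_of_pos hρ0]
      rw [show -(-Real.log ρ / W) * t = Real.log ρ * (t / W) by ring]
      ring
    rw [h1, ← Real.rpow_natCast]
    refine Real.rpow_le_rpow_of_exponent_ge hρ0 hρ1.le ?_
    linarith [Nat.lt_floor_add_one (t / W)]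
  calc ρ ^ ⌊t / W⌋₊ * (2 ^ k * B)
      ≤ ρ⁻¹ * Real.exp (-(-Real.log ρ / W) * t) * (2 ^ k * B) := by gcongr
    _ = _ := by ring

/-! ### A periodic delay with an antiperiodic solution -/

/-- The sawtooth delay of period `P`: the time elapsed since the last multiple of `P`, cut off at
`3 * P / 5`. -/
noncomputable def sawDelay (P t : ℝ) : ℝ := min (t - ⌊t / P⌋ * P) (3 * P / 5)

/-- One half-wave of the extremal solution for the rate `1`, on `[0, 5 / 2]`: it rises from `-1`
with slope `1` up to time `3 / 2` and then along a parabola to its maximum `1`. -/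
noncomputable def halfWave (s : ℝ) : ℝ := s - 1 - max (s - 3 / 2) 0 ^ 2 / 2

/-- The `P`-antiperiodic continuation of the half-wave, rescaled to the rate `5 / (2 * P)`. -/
noncomputable def sawWave (P t : ℝ) : ℝ :=
  (-1) ^ ⌊t / P⌋ * halfWave (5 / (2 * P) * (t - ⌊t / P⌋ * P))

theorem hasDerivAt_halfWave (s : ℝ) : HasDerivAt halfWave (1 - max (s - 3 / 2) 0) s := by
  have hlin : HasDerivAt (fun s : ℝ => s - 1) 1 s := (hasDerivAt_id s).sub_const 1
  have hpar : ∀ s : ℝ, HasDerivAt (fun s : ℝ => s - 1 - (s - 3 / 2) ^ 2 / 2) (1 - (s - 3 / 2)) s :=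
    fun s => by
      have := ((hasDerivAt_id s).sub_const 1).sub
        ((((hasDerivAt_id s).sub_const (3 / 2)).pow 2).div_const 2)
      refine this.congr_deriv ?_
      simp
  have hleft : ∀ p : ℝ, p ≤ 3 / 2 → halfWave p = p - 1 := fun p hp => by
    simp [halfWave, max_eq_right (sub_nonpos.2 hp)]
  have hright : ∀ p : ℝ, 3 / 2 ≤ p → halfWave p = p - 1 - (p - 3 / 2) ^ 2 / 2 := fun p hp => by
    simp [halfWave, max_eq_left (sub_nonneg.2 hp)]
  rcases lt_trichotomy s (3 / 2) with h | h | h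
  · rw [max_eq_right (by linarith), sub_zero]
    exact hlin.congr_of_eventuallyEq
      (Filter.eventuallyEq_of_mem (Iio_mem_nhds h) fun p hp => hleft p (le_of_lt hp))
  · rw [max_eq_right (by linarith), sub_zero, ← hasDerivWithinAt_univ, ← Iic_union_Ici (a := s)]
    refine HasDerivWithinAt.union ?_ ?_
    · exact hlin.hasDerivWithinAt.congr (fun p hp => hleft p (hp.trans h.le)) (hleft s h.le)
    · have := (hpar s).hasDerivWithinAt (s := Ici s)
      rw [show 1 - (s - 3 / 2) = 1 by rw [h]; norm_num] at this
      exact this.congr (fun p hp => hright p (h.ge.trans hp)) (hright s h.ge)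
  · rw [max_eq_left (by linarith)]
    exact (hpar s).congr_of_eventuallyEq
      (Filter.eventuallyEq_of_mem (Ioi_mem_nhds h) fun p hp => hright p (le_of_lt hp))

/-- The half-wave solves the equation of rate `1` with delay `min s (3 / 2)`. -/
theorem neg_halfWave_delayed {s : ℝ} (h : s ≤ 5 / 2) :
    1 - max (s - 3 / 2) 0 = -halfWave (s - min s (3 / 2)) := by
  have h1 : s - min s (3 / 2) = max (s - 3 / 2) 0 := by
    rcases le_total s (3 / 2) with h | h
    · rw [min_eq_left h, max_eq_right (by linarith), sub_self]
    · rw [min_eq_right h, max_eq_left (by linarith)]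
  have h2 : max (s - 3 / 2) 0 ≤ 1 := max_le (by linarith) zero_le_one
  rw [h1, halfWave, max_eq_right (a := max (s - 3 / 2) 0 - 3 / 2) (by linarith)]
  ring

section

variable {P : ℝ}

theorem floor_div_eq (hP : 0 < P) {n : ℤ} {t : ℝ} (h1 : n * P ≤ t) (h2 : t < (n + 1) * P) :
    ⌊t / P⌋ = n :=
  Int.floor_eq_iff.2 ⟨(le_div_iff₀ hP).2 h1, (div_lt_iff₀ hP).2 h2⟩

theorem floor_mul_le (hP : 0 < P) (t : ℝ) : ⌊t / P⌋ * P ≤ t :=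
  (le_div_iff₀ hP).1 (Int.floor_le _)

theorem lt_floor_add_one_mul (hP : 0 < P) (t : ℝ) : t < (⌊t / P⌋ + 1) * P :=
  (div_lt_iff₀ hP).1 (Int.lt_floor_add_one _)

theorem exists_int_mul_le_lt (hP : 0 < P) (t : ℝ) : ∃ n : ℤ, n * P ≤ t ∧ t < (n + 1) * P :=
  ⟨⌊t / P⌋, floor_mul_le hP t, lt_floor_add_one_mul hP t⟩

theorem exists_int_mul_lt_le (hP : 0 < P) (t : ℝ) : ∃ n : ℤ, n * P < t ∧ t ≤ (n + 1) * P := by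
  refine ⟨⌈t / P⌉ - 1, ?_, ?_⟩
  · push_cast
    rw [← lt_div_iff₀ hP]
    linarith [Int.ceil_lt_add_one (t / P)]
  · push_cast
    rw [← div_le_iff₀ hP]
    linarith [Int.le_ceil (t / P)]

theorem sawDelay_eq (hP : 0 < P) {n : ℤ} {t : ℝ} (h1 : n * P ≤ t) (h2 : t < (n + 1) * P) :
    sawDelay P t = min (t - n * P) (3 * P / 5) := by
  rw [sawDelay, floor_div_eq hP h1 h2]

/-- The formula holds on the closed interval because `halfWave (5 / 2) = -halfWave 0`. -/
theorem sawWave_eq (hP : 0 < P) {n : ℤ} {t : ℝ} (h1 : n * P ≤ t) (h2 : t ≤ (n + 1) * P) :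
    sawWave P t = (-1) ^ n * halfWave (5 / (2 * P) * (t - n * P)) := by
  rcases h2.lt_or_eq with h2 | h2
  · rw [sawWave, floor_div_eq hP h1 h2]
  · have : ⌊t / P⌋ = n + 1 := by
      rw [h2, mul_div_cancel_right₀ _ hP.ne']
      exact_mod_cast Int.floor_intCast (n + 1)
    rw [sawWave, this, h2, zpow_add_one₀ (by norm_num)]
    have e1 : 5 / (2 * P) * ((n + 1) * P - ((n + 1 : ℤ) : ℝ) * P) = 0 := by push_cast; ring
    have e2 : 5 / (2 * P) * ((n + 1) * P - n * P) = 5 / 2 := by field_simp; ring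
    rw [e1, e2]
    norm_num [halfWave]

theorem sawDelay_nonneg (hP : 0 < P) (t : ℝ) : 0 ≤ sawDelay P t :=
  le_min (by linarith [floor_mul_le hP t]) (by positivity)

theorem sawDelay_le (P t : ℝ) : sawDelay P t ≤ 3 * P / 5 := min_le_right _ _

theorem tendsto_sawDelay_right (hP : 0 < P) {n : ℤ} {t : ℝ} (h1 : n * P ≤ t)
    (h2 : t < (n + 1) * P) :
    Tendsto (sawDelay P) (𝓝[>] t) (𝓝 (min (t - n * P) (3 * P / 5))) := by
  have hc : Continuous fun r : ℝ => min (r - n * P) (3 * P / 5) := by fun_prop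
  refine (hc.continuousAt.tendsto.mono_left nhdsWithin_le_nhds).congr' ?_
  filter_upwards [Ioo_mem_nhdsGT h2] with r hr
  exact (sawDelay_eq hP (h1.trans hr.1.le) hr.2).symm

theorem tendsto_sawDelay_left (hP : 0 < P) {n : ℤ} {t : ℝ} (h1 : n * P < t)
    (h2 : t ≤ (n + 1) * P) :
    Tendsto (sawDelay P) (𝓝[<] t) (𝓝 (min (t - n * P) (3 * P / 5))) := by
  have hc : Continuous fun r : ℝ => min (r - n * P) (3 * P / 5) := by fun_prop
  refine (hc.continuousAt.tendsto.mono_left nhdsWithin_le_nhds).congr' ?_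
  filter_upwards [Ioo_mem_nhdsLT h1] with r hr
  exact (sawDelay_eq hP hr.1.le (hr.2.trans_le h2)).symm

theorem continuousAt_sawDelay (hP : 0 < P) {n : ℤ} {t : ℝ} (h1 : n * P < t)
    (h2 : t < (n + 1) * P) : ContinuousAt (sawDelay P) t := by
  have hc : Continuous fun r : ℝ => min (r - n * P) (3 * P / 5) := by fun_prop
  refine hc.continuousAt.congr ?_
  filter_upwards [Ioo_mem_nhds h1 h2] with r hr
  exact (sawDelay_eq hP hr.1.le hr.2).symm

theorem not_continuousAt_sawDelay (hP : 0 < P) (n : ℤ) :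
    ¬ ContinuousAt (sawDelay P) (n * P) := by
  intro hc
  have h1 : sawDelay P (n * P) = 0 := by
    rw [sawDelay_eq hP le_rfl (by linarith), sub_self]
    exact min_eq_left (by positivity)
  have h2 := tendsto_sawDelay_left hP (n := n - 1) (t := n * P) (by push_cast; linarith)
    (by push_cast; linarith)
  have h3 := tendsto_nhds_unique h2 (hc.tendsto.mono_left nhdsWithin_le_nhds)
  rw [h1, min_eq_right (by push_cast; linarith)] at h3
  linarith

theorem piecewiseContinuous_sawDelay (hP : 0 < P) :
    PiecewiseContinuous (sawDelay P) := by
  refine ⟨fun T => ?_, fun t _ => ?_, fun t _ => ?_⟩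
  · refine ((Set.finite_Icc (0 : ℤ) ⌊T / P⌋).image fun n : ℤ => (n : ℝ) * P).subset ?_
    rintro t ⟨ht, hnc⟩
    have h1 := floor_mul_le hP t
    refine ⟨⌊t / P⌋, ⟨Int.floor_nonneg.2 (div_nonneg ht.1 hP.le), ?_⟩, ?_⟩
    · exact Int.floor_le_floor (div_le_div_of_nonneg_right ht.2 hP.le)
    · by_contra hne
      exact hnc (continuousAt_sawDelay hP (lt_of_le_of_ne h1 hne)
        (lt_floor_add_one_mul hP t)).continuousWithinAt
  · obtain ⟨n, h1, h2⟩ := exists_int_mul_le_lt hP t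
    exact ⟨_, tendsto_sawDelay_right hP h1 h2⟩
  · obtain ⟨n, h1, h2⟩ := exists_int_mul_lt_le hP t
    exact ⟨_, tendsto_sawDelay_left hP h1 h2⟩

theorem continuous_sawWave (hP : 0 < P) : Continuous (sawWave P) := by
  have hh : Continuous halfWave :=
    continuous_iff_continuousAt.2 fun s => (hasDerivAt_halfWave s).continuousAt
  have hc : ∀ n : ℤ, Continuous fun r : ℝ =>
      (-1 : ℝ) ^ n * halfWave (5 / (2 * P) * (r - n * P)) := fun n => by fun_prop
  rw [continuous_iff_continuousAt]
  intro t
  rw [continuousAt_iff_continuous_left'_right']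
  constructor
  · obtain ⟨n, h1, h2⟩ := exists_int_mul_lt_le hP t
    refine (hc n).continuousWithinAt.congr_of_eventuallyEq ?_ (sawWave_eq hP h1.le h2)
    filter_upwards [Ioo_mem_nhdsLT h1] with r hr
    exact sawWave_eq hP hr.1.le (hr.2.le.trans h2)
  · obtain ⟨n, h1, h2⟩ := exists_int_mul_le_lt hP t
    refine (hc n).continuousWithinAt.congr_of_eventuallyEq ?_ (sawWave_eq hP h1 h2.le)
    filter_upwards [Ioo_mem_nhdsGT h2] with r hr
    exact sawWave_eq hP (h1.trans hr.1.le) hr.2.le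

theorem hasDerivAt_sawWave (hP : 0 < P) {t : ℝ} (ht : ContinuousAt (sawDelay P) t) :
    HasDerivAt (sawWave P) (-(5 / (2 * P)) * sawWave P (t - sawDelay P t)) t := by
  obtain ⟨n, h1, h2⟩ := exists_int_mul_le_lt hP t
  have h1' : n * P < t := lt_of_le_of_ne h1 fun h => not_continuousAt_sawDelay hP n (h ▸ ht)
  set c : ℝ := 5 / (2 * P) with hc
  have hc0 : 0 < c := by positivity
  have hcP : c * P = 5 / 2 := by rw [hc]; field_simp
  have hd : HasDerivAt (fun r : ℝ => (-1 : ℝ) ^ n * halfWave (c * (r - n * P)))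
      ((-1) ^ n * ((1 - max (c * (t - n * P) - 3 / 2) 0) * (c * 1))) t :=
    ((hasDerivAt_halfWave _).comp t
      (((hasDerivAt_id t).sub_const (n * P)).const_mul c)).const_mul _
  have hev : sawWave P =ᶠ[𝓝 t] fun r : ℝ => (-1 : ℝ) ^ n * halfWave (c * (r - n * P)) := by
    filter_upwards [Ioo_mem_nhds h1' h2] with r hr
    exact sawWave_eq hP hr.1.le hr.2.le
  refine (hd.congr_of_eventuallyEq hev).congr_deriv ?_
  have hle : c * (t - n * P) ≤ 5 / 2 := by
    rw [← hcP]; gcongr; linarith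
  have hdel := sawDelay_eq hP h1 h2
  have hdn : sawDelay P t ≤ t - n * P := hdel ▸ min_le_left _ _
  rw [sawWave_eq hP (n := n) (by linarith) (by linarith [sawDelay_nonneg hP t]),
    neg_halfWave_delayed hle, hdel, ← hc]
  have : c * (t - min (t - n * P) (3 * P / 5) - n * P)
      = c * (t - n * P) - min (c * (t - n * P)) (3 / 2) := by
    have h3 : (3 / 2 : ℝ) = c * (3 * P / 5) := by linarith
    rw [h3, ← mul_min_of_nonneg _ _ hc0.le]
    ring
  rw [this]
  ring

theorem abs_sawWave_natCast_mul (hP : 0 < P) (n : ℕ) : |sawWave P (n * P)| = 1 := by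
  have := sawWave_eq hP (n := n) (t := n * P) (by simp) (by push_cast; linarith)
  rw [this]
  norm_num [halfWave, abs_mul]

end

/-! ### Symmetric operators -/

section

variable {E : Type*} [NormedAddCommGroup E] [InnerProductSpace ℝ E] [FiniteDimensional ℝ E]

theorem exists_orthonormalBasis_eigenvectors {T : E →ₗ[ℝ] E} (hT : T.IsSymmetric)
    (hneg : ∀ u, u ≠ 0 → inner ℝ u (T u) < 0) :
    ∃ (b : OrthonormalBasis (Fin (Module.finrank ℝ E)) ℝ E) (μ : Fin (Module.finrank ℝ E) → ℝ),
      (∀ i, T (b i) = μ i • b i) ∧ (∀ i, inner ℝ (b i) (T (b i)) = μ i) ∧ ∀ i, μ i < 0 := by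
  set b := hT.eigenvectorBasis rfl
  set μ := hT.eigenvalues rfl
  have hTb : ∀ i, T (b i) = μ i • b i := hT.apply_eigenvectorBasis rfl
  have hval : ∀ i, inner ℝ (b i) (T (b i)) = μ i := fun i => by
    rw [hTb, inner_smul_right, real_inner_self_eq_norm_sq, b.norm_eq_one, one_pow, mul_one]
  exact ⟨b, μ, hTb, hval, fun i => hval i ▸ hneg _ (b.orthonormal.ne_zero i)⟩

/-- The supremum of the Rayleigh quotients of a negative definite symmetric operator is attained
at an eigenvector, with eigenvalue the negative of the supremum. -/
theorem exists_eigenvector_neg_sSup_rayleigh [Nontrivial E] {T : E →ₗ[ℝ] E} (hT : T.IsSymmetric)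
    (hneg : ∀ u, u ≠ 0 → inner ℝ u (T u) < 0) {L : ℝ}
    (hL : L = sSup {q : ℝ | ∃ u : E, u ≠ 0 ∧ q = |inner ℝ u (T u)| / inner ℝ u u}) :
    0 < L ∧ (∃ u, u ≠ 0 ∧ T u = -L • u) ∧ ∀ w, |inner ℝ w (T w)| ≤ L * inner ℝ w w := by
  obtain ⟨b, μ, hTb, hval, hμneg⟩ := exists_orthonormalBasis_eigenvectors hT hneg
  have : NeZero (Module.finrank ℝ E) := ⟨(Module.finrank_pos (R := ℝ) (M := E)).ne'⟩
  obtain ⟨i, hi⟩ := Finite.exists_max fun i => |μ i|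
  have hbi : ∀ i, inner ℝ (b i) (b i) = (1 : ℝ) := fun i => by
    rw [real_inner_self_eq_norm_sq, b.norm_eq_one]; norm_num
  have hb0 : ∀ i, b i ≠ 0 := fun i => b.orthonormal.ne_zero i
  have hbound : ∀ w, |inner ℝ w (T w)| ≤ |μ i| * inner ℝ w w := by
    intro w
    rw [← b.sum_inner_mul_inner w (T w), ← b.sum_inner_mul_inner w w, Finset.mul_sum]
    refine (Finset.abs_sum_le_sum_abs _ _).trans (Finset.sum_le_sum fun j _ => ?_)
    rw [← hT (b j) w, hTb, real_inner_smul_left, real_inner_comm w (b j)]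
    have : |inner ℝ (b j) w * (μ j * inner ℝ (b j) w)|
        = |μ j| * (inner ℝ (b j) w * inner ℝ (b j) w) := by
      rw [abs_mul, abs_mul, mul_left_comm, abs_mul_abs_self]
    rw [real_inner_comm (b j) w, this]
    exact mul_le_mul_of_nonneg_right (hi j) (mul_self_nonneg _)
  have hgreat : IsGreatest {q : ℝ | ∃ u : E, u ≠ 0 ∧ q = |inner ℝ u (T u)| / inner ℝ u u}
      |μ i| := by
    refine ⟨⟨b i, hb0 i, by rw [hval, hbi, div_one]⟩, ?_⟩
    rintro q ⟨u, hu, rfl⟩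
    have : 0 < inner ℝ u u := real_inner_self_pos.2 hu
    rw [div_le_iff₀ this]
    exact hbound u
  have hLi : L = |μ i| := hL.trans hgreat.csSup_eq
  refine ⟨hLi ▸ abs_pos.2 (hμneg i).ne, ⟨b i, hb0 i, ?_⟩, hLi ▸ hbound⟩
  rw [hTb, hLi, abs_of_neg (hμneg i), neg_neg]

/-- Exponential stability of `v'(t) = T (v (t - τ t))` for a negative definite symmetric `T` with
`r * L < 3 / 2`, where `L` bounds the Rayleigh quotients: each coordinate in an eigenbasis solves a
scalar equation. -/
theorem exists_exp_decay_of_symmetric {T : E →ₗ[ℝ] E} (hT : T.IsSymmetric)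
    (hneg : ∀ u, u ≠ 0 → inner ℝ u (T u) < 0) {L r : ℝ}
    (hL : ∀ w, |inner ℝ w (T w)| ≤ L * inner ℝ w w) (hr : 0 ≤ r) (hrL : r * L < 3 / 2) :
    ∃ M γ : ℝ, 0 < M ∧ 0 < γ ∧ ∀ (S : Set ℝ) (τ : ℝ → ℝ) (v : ℝ → E),
      (∀ t, 0 ≤ t → 0 ≤ τ t ∧ τ t ≤ r) → (∀ R : ℝ, (S ∩ Icc 0 R).Finite) →
      ContinuousOn v (Ici (-r)) → (∀ t, 0 < t → t ∉ S → HasDerivAt v (T (v (t - τ t))) t) →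
      ∀ t, 0 ≤ t → ‖v t‖ ≤ M * Real.exp (-γ * t) * sSup ((fun s => ‖v s‖) '' Icc (-r) 0) := by
  obtain ⟨b, μ, hTb, hval, hμneg⟩ := exists_orthonormalBasis_eigenvectors hT hneg
  have hμL : ∀ i, -μ i ≤ L := fun i => by
    have := hL (b i)
    rw [hval, real_inner_self_eq_norm_sq, b.norm_eq_one, one_pow, mul_one] at this
    exact (neg_le_abs _).trans this
  have hex : ∀ i, -μ i * r < 3 / 2 := fun i =>
    lt_of_le_of_lt (by nlinarith [hμL i]) hrL
  choose M γ hM hγ hdec using fun i => exists_exp_decay_scalar (neg_pos.2 (hμneg i)) (hex i)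
  obtain ⟨γ₀, hγ₀, hγle⟩ : ∃ γ₀, 0 < γ₀ ∧ ∀ i, γ₀ ≤ γ i := by
    rcases isEmpty_or_nonempty (Fin (Module.finrank ℝ E)) with h | h
    · exact ⟨1, one_pos, fun i => h.elim i⟩
    · obtain ⟨i, hi⟩ := Finite.exists_min γ
      exact ⟨γ i, hγ i, hi⟩
  refine ⟨1 + ∑ i, M i, γ₀, add_pos_of_pos_of_nonneg one_pos
    (Finset.sum_nonneg fun i _ => (hM i).le), hγ₀, ?_⟩
  intro S τ v hτ hS hv hd t ht
  set B := sSup ((fun s => ‖v s‖) '' Icc (-r) 0) with hB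
  have hbdd : BddAbove ((fun s => ‖v s‖) '' Icc (-r) 0) :=
    (isCompact_Icc.image_of_continuousOn (hv.mono fun s hs => hs.1).norm).bddAbove
  have hle : ∀ s ∈ Icc (-r) 0, ‖v s‖ ≤ B := fun s hs => le_csSup hbdd ⟨s, hs, rfl⟩
  have hB0 : 0 ≤ B := (norm_nonneg _).trans (hle 0 ⟨by linarith, le_rfl⟩)
  have hcoord : ∀ i, IsScalarDelaySolution (-μ i) r S τ fun t => inner ℝ (b i) (v t) := fun i =>
    { lam_pos := neg_pos.2 (hμneg i)
      r_nonneg := hr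
      continuousOn := continuousOn_const.inner hv
      delay_nonneg := fun t ht => (hτ t ht).1
      delay_le := fun t ht => (hτ t ht).2
      finite := hS
      hasDerivAt := fun t ht htS => by
        have h1 := (innerSL ℝ (b i)).hasFDerivAt.comp_hasDerivAt t (hd t ht htS)
        have h2 : innerSL ℝ (b i) (T (v (t - τ t))) = - -μ i * inner ℝ (b i) (v (t - τ t)) := by
          rw [innerSL_apply_apply, ← hT, hTb, real_inner_smul_left, neg_neg]
        rw [h2] at h1
        exact h1 }
  have hi : ∀ i, |inner ℝ (b i) (v t)| ≤ M i * Real.exp (-γ₀ * t) * B := fun i => by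
    refine (hdec i S τ _ B (hcoord i) (fun s hs => ?_) t ht).trans ?_
    · have := abs_real_inner_le_norm (b i) (v s)
      rw [b.norm_eq_one, one_mul] at this
      exact this.trans (hle s hs)
    · have := hγle i
      have := (hM i).le
      gcongr
  calc ‖v t‖ = ‖∑ i, inner ℝ (b i) (v t) • b i‖ := by rw [b.sum_repr']
    _ ≤ ∑ i, ‖inner ℝ (b i) (v t) • b i‖ := norm_sum_le _ _
    _ = ∑ i, |inner ℝ (b i) (v t)| := by simp [norm_smul]
    _ ≤ ∑ i, M i * Real.exp (-γ₀ * t) * B := Finset.sum_le_sum fun i _ => hi i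
    _ = (∑ i, M i) * Real.exp (-γ₀ * t) * B := by rw [← Finset.sum_mul, ← Finset.sum_mul]
    _ ≤ _ := by gcongr; linarith

end

/-! ### The graph Laplacian -/

section

variable {N : ℕ} (G : WGraph N) (d : ℕ)

/-- The Laplacian is minus one half of the Dirichlet form. -/
theorem WGraph.two_mul_inner_laplacian (u v : L2 N d) :
    2 * inner ℝ u (G.laplacian d v)
      = -∑ x, ∑ y, G.weight x y * inner ℝ (u y - u x) (v y - v x) := by
  have h1 : inner ℝ u (G.laplacian d v)
      = ∑ x, ∑ y, G.weight x y * inner ℝ (u x) (v y - v x) := by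
    rw [PiLp.inner_apply]
    refine Finset.sum_congr rfl fun x _ => ?_
    change inner ℝ (u x) (∑ y, G.weight x y • pd v y x) = _
    rw [inner_sum]
    refine Finset.sum_congr rfl fun y _ => ?_
    rw [real_inner_smul_right, pd]
  have h2 : inner ℝ u (G.laplacian d v)
      = ∑ x, ∑ y, G.weight x y * inner ℝ (u y) (v x - v y) := by
    rw [h1, Finset.sum_comm]
    refine Finset.sum_congr rfl fun x _ => Finset.sum_congr rfl fun y _ => ?_
    rw [G.weight_symm]
  rw [two_mul]
  nth_rewrite 1 [h1]
  rw [h2, ← Finset.sum_add_distrib, ← Finset.sum_neg_distrib]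
  refine Finset.sum_congr rfl fun x _ => ?_
  rw [← Finset.sum_add_distrib, ← Finset.sum_neg_distrib]
  refine Finset.sum_congr rfl fun y _ => ?_
  rw [inner_sub_left, ← neg_sub (v y) (v x), inner_neg_right]
  ring

theorem WGraph.isSymmetric_laplacianH1 :
    LinearMap.IsSymmetric (𝕜 := ℝ) (E := H1 N d) (G.laplacianH1 d) := by
  intro u v
  have h1 := G.two_mul_inner_laplacian d (u : L2 N d) v
  have h2 := G.two_mul_inner_laplacian d (v : L2 N d) u
  have h3 : ∑ x, ∑ y, G.weight x y * inner ℝ ((u : L2 N d) y - (u : L2 N d) x)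
        ((v : L2 N d) y - (v : L2 N d) x)
      = ∑ x, ∑ y, G.weight x y * inner ℝ ((v : L2 N d) y - (v : L2 N d) x)
        ((u : L2 N d) y - (u : L2 N d) x) :=
    Finset.sum_congr rfl fun x _ => Finset.sum_congr rfl fun y _ => by rw [real_inner_comm]
  rw [real_inner_comm]
  change inner ℝ (v : L2 N d) (G.laplacian d u) = inner ℝ (u : L2 N d) (G.laplacian d v)
  linarith

variable {G} in
/-- By connectedness the Dirichlet form vanishes only on constants, and the only constant with
zero average is `0`. -/
theorem WGraph.Connected.inner_laplacianH1_neg (hG : G.Connected) {u : H1 N d} (hu : u ≠ 0) :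
    inner ℝ u (G.laplacianH1 d u) < 0 := by
  change inner ℝ (u : L2 N d) (G.laplacian d u) < 0
  have h1 := G.two_mul_inner_laplacian d (u : L2 N d) u
  have hterm : ∀ x y, 0 ≤ G.weight x y * inner ℝ ((u : L2 N d) y - (u : L2 N d) x)
      ((u : L2 N d) y - (u : L2 N d) x) := fun x y =>
    mul_nonneg (G.weight_nonneg x y) real_inner_self_nonneg
  have hsum : ∀ x, 0 ≤ ∑ y, G.weight x y * inner ℝ ((u : L2 N d) y - (u : L2 N d) x)
      ((u : L2 N d) y - (u : L2 N d) x) := fun x => Finset.sum_nonneg fun y _ => hterm x y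
  by_contra hcon
  have h0 := le_antisymm (by linarith)
    (Finset.sum_nonneg fun x (_ : x ∈ Finset.univ) => hsum x)
  have hadj : ∀ x y, G.Adj x y → (u : L2 N d) x = (u : L2 N d) y := by
    intro x y hxy
    have hx := (Finset.sum_eq_zero_iff_of_nonneg fun x _ => hsum x).1 h0 x (Finset.mem_univ x)
    have hy := (Finset.sum_eq_zero_iff_of_nonneg fun y _ => hterm x y).1 hx y (Finset.mem_univ y)
    rcases mul_eq_zero.1 hy with h | h
    · exact absurd h ((G.weight_pos_iff x y).2 hxy).ne'
    · exact (sub_eq_zero.1 (inner_self_eq_zero.1 h)).symm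
  have hconst : ∀ x y, (u : L2 N d) x = (u : L2 N d) y := by
    intro x y
    induction hG x y with
    | refl => rfl
    | tail _ hbc ih => exact ih.trans (hadj _ _ hbc)
  refine hu (Subtype.ext (PiLp.ext fun x => ?_))
  have hN : (N : ℝ) ≠ 0 := Nat.cast_ne_zero.2 (Nat.pos_of_ne_zero fun h => by
    subst h; exact x.elim0).ne'
  have hav : (N : ℝ)⁻¹ • ∑ y, (u : L2 N d) y = 0 := u.2
  rw [Finset.sum_congr rfl fun y _ => hconst y x, Finset.sum_const, Finset.card_univ,
    Fintype.card_fin, ← Nat.cast_smul_eq_nsmul ℝ, smul_smul, inv_mul_cancel₀ hN, one_smul] at hav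
  exact hav

theorem nontrivial_H1 {N d : ℕ} (hN : 2 ≤ N) (hd : 1 ≤ d) : Nontrivial (H1 N d) := by
  have : Nonempty (Fin d) := ⟨⟨0, hd⟩⟩
  obtain ⟨e, he⟩ := exists_ne (0 : EuclideanSpace ℝ (Fin d))
  let a : Fin N := ⟨0, by omega⟩
  let b : Fin N := ⟨1, by omega⟩
  have hab : a ≠ b := by simp [a, b]
  -- `e` at one node, `-e` at another
  let f : L2 N d := WithLp.toLp 2 (Pi.single a e - Pi.single b e)
  have hf : f ∈ H1 N d := by
    rw [H1, LinearMap.mem_ker]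
    change (N : ℝ)⁻¹ • ∑ x, ((Pi.single a e : Fin N → EuclideanSpace ℝ (Fin d)) x
      - (Pi.single b e : Fin N → EuclideanSpace ℝ (Fin d)) x) = 0
    rw [Finset.sum_sub_distrib]
    simp
  refine ⟨⟨⟨f, hf⟩, 0, fun h => he ?_⟩⟩
  have h1 : f a = 0 := congrArg (fun g : H1 N d => (g : L2 N d) a) h
  have h2 : f a = e := by simp [f, hab]
  rw [← h2, h1]

end

/-! ### Stability threshold -/

/-- The sawtooth delay admits a solution of constant norm along a sequence of times. -/
theorem WGraph.not_stable_sawDelay {N d : ℕ} (G : WGraph N) {L r : ℝ}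
    (hL : 0 < L) {u : H1 N d} (hu : u ≠ 0) (hLu : G.laplacianH1 d u = -L • u) :
    ¬ G.GloballyExponentiallyStable d r (sawDelay (5 / (2 * L))) := by
  set P : ℝ := 5 / (2 * L) with hPdef
  have hP : 0 < P := by positivity
  have hLP : 5 / (2 * P) = L := by rw [hPdef]; field_simp
  rintro ⟨M, γ, hM, hγ, hst⟩
  have hsol : G.IsSolution d r (sawDelay P) fun t => sawWave P t • u := by
    refine ⟨((continuous_sawWave hP).smul continuous_const).continuousOn, fun t _ hc => ?_⟩
    have h1 := (hasDerivAt_sawWave hP hc).smul_const u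
    rw [map_smul, hLu, smul_smul]
    rw [hLP] at h1
    exact h1.congr_deriv (by congr 1; ring)
  have hb := hst _ hsol
  set B := sSup ((fun s => ‖sawWave P s • u‖) '' Icc (-r) 0)
  have hlow : ∀ n : ℕ, ‖u‖ ≤ M * Real.exp (-γ * (n * P)) * B := fun n => by
    have := hb (n * P) (by positivity)
    rwa [norm_smul, Real.norm_eq_abs, abs_sawWave_natCast_mul hP, one_mul] at this
  have hlim : Tendsto (fun n : ℕ => M * Real.exp (-γ * (n * P)) * B) atTop (𝓝 (M * 0 * B)) := by
    refine (Tendsto.const_mul M (Real.tendsto_exp_atBot.comp ?_)).mul_const B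
    exact (tendsto_natCast_atTop_atTop.atTop_mul_const hP).const_mul_atTop_of_neg
      (neg_neg_of_pos hγ)
  have := ge_of_tendsto' hlim hlow
  rw [mul_zero, zero_mul] at this
  exact hu (norm_le_zero_iff.1 this)

end DelayConsensus

theorem mainTheorem2 {N d : ℕ} (hN : 2 ≤ N) (hd : 1 ≤ d) (G : DelayConsensus.WGraph N)
    (hG : G.Connected) (τbar : ℝ) (hτbar : 0 ≤ τbar) :
    (∀ τ : ℝ → ℝ, DelayConsensus.PiecewiseContinuous τ →
        (∀ t : ℝ, 0 ≤ t → 0 ≤ τ t ∧ τ t ≤ τbar) →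
        G.GloballyExponentiallyStable d τbar τ) ↔
      τbar < 3 / (2 * G.laplacianNorm d) := by
  have := DelayConsensus.nontrivial_H1 hN hd
  have hsymm := G.isSymmetric_laplacianH1 d
  have hneg : ∀ u, u ≠ 0 → inner ℝ u (G.laplacianH1 d u) < 0 := fun u hu =>
    hG.inner_laplacianH1_neg d hu
  obtain ⟨hL, ⟨u, hu, hLu⟩, hbound⟩ :=
    DelayConsensus.exists_eigenvector_neg_sSup_rayleigh hsymm hneg (L := G.laplacianNorm d) rfl
  set L := G.laplacianNorm d
  constructor
  · intro hstab
    by_contra hlt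
    have hP : 0 < 5 / (2 * L) := by positivity
    have h35 : 3 * (5 / (2 * L)) / 5 = 3 / (2 * L) := by field_simp
    refine G.not_stable_sawDelay hL hu hLu (hstab _
      (DelayConsensus.piecewiseContinuous_sawDelay hP) fun t _ =>
      ⟨DelayConsensus.sawDelay_nonneg hP t, (DelayConsensus.sawDelay_le _ t).trans ?_⟩)
    rw [h35]
    exact not_lt.1 hlt
  · intro hlt τ hpc hτ
    have hrL : τbar * L < 3 / 2 := by
      rw [lt_div_iff₀ (by positivity)] at hlt
      linarith
    obtain ⟨M, γ, hM, hγ, hdec⟩ :=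
      DelayConsensus.exists_exp_decay_of_symmetric hsymm hneg hbound hτbar hrL
    refine ⟨M, γ, hM, hγ, fun v hv => ?_⟩
    -- At positive times, continuity of `τ` on `[0, ∞)` is plain continuity.
    have hat : ∀ t, 0 < t → ContinuousWithinAt τ (Ici 0) t → ContinuousAt τ t := fun t ht hc =>
      hc.continuousAt (Ici_mem_nhds ht)
    refine hdec {t | ¬ ContinuousWithinAt τ (Ici 0) t} τ v hτ (fun R => ?_) hv.1
      fun t ht hS => hv.2 t ht (hat t ht (not_not.1 hS))
    exact (hpc.1 R).subset fun t ht => ⟨ht.2, ht.1⟩
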